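/- Let $\mathbb T\subseteq\mathbb R$ be a time scale (a nonempty closed set) that is unbounded above and has bounded graininess; write $\sigma(t)=\inf\{s\in\mathbb T: s>t\}$ and $\mu(t)=\sigma(t)-t$. Let $A\in\mathbb R^{n\times n}$ and $B\in\mathbb R^{n\times m}$, assume that $A$ is regressive, i.e. $I+\mu(t)A$ is invertible for every $t\in\mathbb T$, and let $t_0\in\mathbb T$. Consider the time invariant linear system $$x^{\Delta}(t)=Ax(t)+Bu(t),\qquad x(t_0)=x_0,\qquad t\in\mathbb T,\ t\ge t_0,$$ (with any output $y=Cx$), where $x^\Delta$ is the delta derivative. For $t_f\in\mathbb T$, $t_f>t_0$, the system is called controllable on $[t_0,t_f]$ if for all $x_0,x_f\in\mathbb R^n$ there is an rd-continuous input $u:\mathbb T\to\mathbb R^m$ such that the corresponding solution satisfies $x(t_f)=x_f$. It is called controllable if it is controllable on $[t_0,t_f]$ for some $t_f\in\mathbb T$ with $t_f>t_0$. Then the following are equivalent: 1. the system is controllable; 2. $\operatorname{rank}\begin{bmatrix} zI-A & B\end{bmatrix}=n$ for every $z\in\mathbb C$; 3. for every $\lambda\in\mathbb C$, the only $p\in\mathbb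 C^n$ with $p^TA=\lambda p^T$ and $p^TB=0$ is $p=0$ (no left eigenvector of $A$ is orthogonal to the columns of $B$). Moreover, if $t_f\in\mathbb T$, $t_f>t_0$ and $[t_0,t_f)\cap\mathbb T$ has at least $n$ points, then the system is controllable on $[t_0,t_f]$ if and only if condition 2 holds. -/

import Mathlib

open Set Filter Topology

/-- The forward jump `σ(t) = inf {s ∈ T : s > t}` of a time scale `T ⊆ ℝ`
(used only for `T` unbounded above, where this set is never empty). -/
noncomputable def forwardJump (T : Set ℝ) (t : ℝ) : ℝ := sInf (T ∩ Ioi t)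

/-- The graininess `μ(t) = σ(t) - t`. -/
noncomputable def graininess (T : Set ℝ) (t : ℝ) : ℝ := forwardJump T t - t

/-- `a` is the delta (Hilger) derivative at `t` of the function `f` on the time scale `T`: for
every `ε > 0`, `‖f (σ t) - f s - (σ t - s) a‖ ≤ ε |σ t - s|` for all `s ∈ T` near `t`.
Only the values of `f` on `T` matter. -/
def HasDeltaDerivAt {E : Type*} [NormedAddCommGroup E] [NormedSpace ℝ E]
    (T : Set ℝ) (f : ℝ → E) (a : E) (t : ℝ) : Prop :=
  ∀ ε > 0, ∀ᶠ s in 𝓝[T] t,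
    ‖f (forwardJump T t) - f s - (forwardJump T t - s) • a‖ ≤ ε * |forwardJump T t - s|

/-- `f` is rd-continuous on `T`: continuous at the right-dense points of `T`, with finite left
limits at the left-dense points of `T`. (At a point of `T` that is not a limit of smaller
points of `T`, the filter `𝓝[T ∩ Iio t] t` is trivial, so nothing is required there.) -/
def RdContinuousOn {E : Type*} [TopologicalSpace E] (T : Set ℝ) (f : ℝ → E) : Prop :=
  (∀ t ∈ T, forwardJump T t = t → ContinuousWithinAt f T t) ∧
  (∀ t ∈ T, ∃ l : E, Tendsto f (𝓝[T ∩ Iio t] t) (𝓝 l))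

/-- The matrix `A` is regressive on `T`: `I + μ(t) A` is invertible for every `t ∈ T`. -/
def IsRegressive {n : ℕ} (T : Set ℝ) (A : Matrix (Fin n) (Fin n) ℝ) : Prop :=
  ∀ t ∈ T, IsUnit (1 + graininess T t • A)

/-- `x` solves `x^Δ(t) = A x(t) + B u(t)`, `x(t₀) = x₀`, on the time scale `T ∩ [t₀, ∞)`. -/
def IsStateSolution {n m : ℕ} (T : Set ℝ) (A : Matrix (Fin n) (Fin n) ℝ)
    (B : Matrix (Fin n) (Fin m) ℝ) (u : ℝ → Fin m → ℝ) (t₀ : ℝ) (x₀ : Fin n → ℝ)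
    (x : ℝ → Fin n → ℝ) : Prop :=
  x t₀ = x₀ ∧
  ∀ t ∈ T ∩ Ici t₀, HasDeltaDerivAt (T ∩ Ici t₀) x (A.mulVec (x t) + B.mulVec (u t)) t

/-- Controllability on `[t₀, t_f]`: every initial state can be driven to every final state at
time `t_f` by some rd-continuous input. The output `y = C x + D u` plays no role. -/
def IsControllableOn {n m : ℕ} (T : Set ℝ) (A : Matrix (Fin n) (Fin n) ℝ)
    (B : Matrix (Fin n) (Fin m) ℝ) (t₀ tf : ℝ) : Prop :=
  ∀ x₀ xf : Fin n → ℝ, ∃ u : ℝ → Fin m → ℝ, RdContinuousOn T u ∧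
    ∃ x : ℝ → Fin n → ℝ, IsStateSolution T A B u t₀ x₀ x ∧ x tf = xf

/-- Controllability (in finite time) of the system started at `t₀`: it is controllable on
`[t₀, t_f]` for some `t_f ∈ T` with `t_f > t₀`. -/
def IsControllable {n m : ℕ} (T : Set ℝ) (A : Matrix (Fin n) (Fin n) ℝ)
    (B : Matrix (Fin n) (Fin m) ℝ) (t₀ : ℝ) : Prop :=
  ∃ tf ∈ T, t₀ < tf ∧ IsControllableOn T A B t₀ tf

/-- `rank [zI - A  B] = n` for every complex `z`. -/
def PBHRankCondition {n m : ℕ} (A : Matrix (Fin n) (Fin n) ℝ)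
    (B : Matrix (Fin n) (Fin m) ℝ) : Prop :=
  ∀ z : ℂ, (Matrix.fromCols (z • (1 : Matrix (Fin n) (Fin n) ℂ) - A.map Complex.ofReal)
    (B.map Complex.ofReal)).rank = n

/-- For every complex `lam`, the only complex vector `p` with `pᵀ A = lam pᵀ` and `pᵀ B = 0`
is `p = 0`. -/
def PBHEigenvectorCondition {n m : ℕ} (A : Matrix (Fin n) (Fin n) ℝ)
    (B : Matrix (Fin n) (Fin m) ℝ) : Prop :=
  ∀ (lam : ℂ) (p : Fin n → ℂ), Matrix.vecMul p (A.map Complex.ofReal) = lam • p →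
    Matrix.vecMul p (B.map Complex.ofReal) = 0 → p = 0

/-! ### Order structure of a time scale: jumps, dense points, induction -/

section Jump

variable {S : Set ℝ}

/-! Both algebraic conditions say that `[zI - A B]` has trivial left kernel. If `pᵀA = λpᵀ` and `pᵀB
= 0`, then `pᵀx` solves `y^Δ = λy` whatever the input. Started at zero it stays zero
(`eq_zero_of_norm_deltaDeriv_le`), so reaching every basis vector forces `p = 0`.

The converse is by duality, without a matrix exponential or a Gramian. Let `q` be orthogonal to the
states reachable from the origin, and let the costate `v` solve `v^Δ = -v^σ A`, `v(tf) = q`. By the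
product rule `(v · x)^Δ = v^σ B u`. With `u = v^σ B` the function `v · x` is nondecreasing and
vanishes at both ends, so `v^σ B = 0` (`vecMul_eq_zero_of_orthogonal_reachable`). Repeated
differentiation gives `v^σ A^k B = 0`, at the cost of one jump each time; `n` points before `tf`
leave room for all `k < n`. Hence `q A^k B = 0` for `k < n`, then for all `k` by Cayley-Hamilton,
and the eigenvector condition gives `q = 0`.

State and costate are obtained from ordinary integral equations on `ℝ` whose integrands are frozen
on the gaps of the time scale. -/

theorem exists_mem_gt_of_not_bddAbove (hu : ¬ BddAbove S) (t : ℝ) : (S ∩ Ioi t).Nonempty := by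
  obtain ⟨s, hs, hts⟩ := not_bddAbove_iff.1 hu t
  exact ⟨s, hs, hts⟩

theorem forwardJump_bddBelow (S : Set ℝ) (t : ℝ) : BddBelow (S ∩ Ioi t) :=
  ⟨t, fun _ hs => le_of_lt hs.2⟩

theorem forwardJump_le {t s : ℝ} (hs : s ∈ S) (hts : t < s) : forwardJump S t ≤ s :=
  csInf_le (forwardJump_bddBelow S t) ⟨hs, hts⟩

theorem le_forwardJump (hu : ¬ BddAbove S) (t : ℝ) : t ≤ forwardJump S t :=
  le_csInf (exists_mem_gt_of_not_bddAbove hu t) fun _ hs => le_of_lt hs.2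

theorem forwardJump_mem (hS : IsClosed S) (hu : ¬ BddAbove S) (t : ℝ) : forwardJump S t ∈ S :=
  closure_minimal inter_subset_left hS
    (csInf_mem_closure (exists_mem_gt_of_not_bddAbove hu t) (forwardJump_bddBelow S t))

theorem forwardJump_mono (hu : ¬ BddAbove S) : Monotone (forwardJump S) := fun _ t hst =>
  csInf_le_csInf (forwardJump_bddBelow S _) (exists_mem_gt_of_not_bddAbove hu t)
    fun _ hr => ⟨hr.1, lt_of_le_of_lt hst hr.2⟩

theorem forwardJump_inter_Ici (T : Set ℝ) {a t : ℝ} (h : a ≤ t) :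
    forwardJump (T ∩ Ici a) t = forwardJump T t := by
  unfold forwardJump
  congr 1
  ext s
  simp only [mem_inter_iff, mem_Ici, mem_Ioi]
  constructor
  · rintro ⟨⟨h1, -⟩, h2⟩; exact ⟨h1, h2⟩
  · rintro ⟨h1, h2⟩; exact ⟨⟨h1, by linarith⟩, h2⟩

theorem exists_mem_Ioo_of_forwardJump_eq (hu : ¬ BddAbove S) {t b : ℝ}
    (h : forwardJump S t = t) (hb : t < b) : ∃ s ∈ S, t < s ∧ s < b := by
  have : sInf (S ∩ Ioi t) < b := by rw [← h] at hb; exact hb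
  obtain ⟨s, hs, hsb⟩ := exists_lt_of_csInf_lt (exists_mem_gt_of_not_bddAbove hu t) this
  exact ⟨s, hs.1, hs.2, hsb⟩

/-- A point of a closed set is either the forward jump of an earlier point or a limit of earlier
points, unless it is the least element. -/
theorem exists_forwardJump_eq_or_left_dense (hS : IsClosed S) (hu : ¬ BddAbove S) {t s₀ : ℝ}
    (ht : t ∈ S) (hs₀ : s₀ ∈ S) (hst : s₀ < t) :
    (∃ r ∈ S, s₀ ≤ r ∧ r < t ∧ forwardJump S r = t) ∨
      ∀ c < t, ∃ s ∈ S, s₀ ≤ s ∧ c < s ∧ s < t := by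
  have hne : (S ∩ Iio t).Nonempty := ⟨s₀, hs₀, hst⟩
  have hbd : BddAbove (S ∩ Iio t) := ⟨t, fun _ hs => le_of_lt hs.2⟩
  have hle : sSup (S ∩ Iio t) ≤ t := csSup_le hne fun _ hs => le_of_lt hs.2
  have hge : s₀ ≤ sSup (S ∩ Iio t) := le_csSup hbd ⟨hs₀, hst⟩
  have hmem : sSup (S ∩ Iio t) ∈ S := closure_minimal inter_subset_left hS
    (csSup_mem_closure hne hbd)
  -- If the supremum of the earlier points lies below `t`, nothing separates it from `t`, so it
  -- jumps to `t`.
  rcases hle.lt_or_eq with h | h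
  · refine Or.inl ⟨_, hmem, hge, h, le_antisymm (forwardJump_le ht h) ?_⟩
    refine le_csInf (exists_mem_gt_of_not_bddAbove hu _) fun s hs => ?_
    by_contra! hlt
    exact absurd (le_csSup hbd ⟨hs.1, hlt⟩) (not_le.2 hs.2)
  · refine Or.inr fun c hc => ?_
    obtain ⟨s, hs, hcs⟩ := exists_lt_of_lt_csSup hne (by rw [h]; exact max_lt hc hst)
    exact ⟨s, hs.1, (le_max_right _ _).trans hcs.le, (le_max_left _ _).trans_lt hcs, hs.2⟩

/-- Induction on a time scale. -/
theorem timeScale_induction (hS : IsClosed S) (hu : ¬ BddAbove S) {a b : ℝ} (P : ℝ → Prop)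
    (ha : a ∈ S) (h0 : P a)
    (hscat : ∀ t ∈ S, a ≤ t → t < b → t < forwardJump S t → P t → P (forwardJump S t))
    (hright : ∀ t ∈ S, a ≤ t → t < b → forwardJump S t = t → P t → ∀ᶠ s in 𝓝[S ∩ Ioi t] t, P s)
    (hleft : ∀ t ∈ S, a < t → t ≤ b → (∀ c < t, ∃ s ∈ S, a ≤ s ∧ c < s ∧ s < t) →
      (∀ s ∈ S, a ≤ s → s < t → P s) → P t) :
    ∀ t ∈ S, a ≤ t → t ≤ b → P t := by
  intro t₁ ht₁ hat₁ htb
  by_contra hP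
  -- Consider the infimum `c` of the failures. If `P c` holds, a step to the right carries `P` past
  -- `c`; if not, `P` holds at all earlier points and must reach `c` by a jump or a left limit.
  set N : Set ℝ := {t | t ∈ S ∧ a ≤ t ∧ t ≤ b ∧ ¬ P t} with hN
  have hne : N.Nonempty := ⟨t₁, ht₁, hat₁, htb, hP⟩
  have hbd : BddBelow N := ⟨a, fun t ht => ht.2.1⟩
  set c := sInf N with hc
  have hcS : c ∈ S := closure_minimal (fun t ht => ht.1) hS (csInf_mem_closure hne hbd)
  have hac : a ≤ c := le_csInf hne fun t ht => ht.2.1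
  have hcb : c ≤ b := (csInf_le hbd ⟨ht₁, hat₁, htb, hP⟩).trans htb
  have hlt : ∀ s ∈ S, a ≤ s → s < c → P s := fun s hs has hsc => by
    by_contra hps
    exact absurd (csInf_le hbd ⟨hs, has, hsc.le.trans hcb, hps⟩) (not_le.2 hsc)
  by_cases hPc : P c
  · have hcN : ∀ t ∈ N, c < t := fun t ht => lt_of_le_of_ne (csInf_le hbd ht) fun h =>
      ht.2.2.2 (h ▸ hPc)
    have hcb' : c < b := (hcN t₁ ⟨ht₁, hat₁, htb, hP⟩).trans_le htb
    rcases (le_forwardJump hu c).lt_or_eq with h | h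
    · have hσ := hscat c hcS hac hcb' h hPc
      have hσle : forwardJump S c ≤ c := le_csInf hne fun t ht =>
        forwardJump_le ht.1 (hcN t ht)
      exact absurd h (not_lt.2 hσle)
    · have hev := hright c hcS hac hcb' h.symm hPc
      obtain ⟨δ, hδ, hball⟩ := Metric.mem_nhdsWithin_iff.1 hev
      obtain ⟨t, ht, htδ⟩ := exists_lt_of_csInf_lt hne (show sInf N < c + δ by linarith)
      have hct := hcN t ht
      refine ht.2.2.2 (hball ⟨?_, ht.1, hct⟩)
      rw [Metric.mem_ball, Real.dist_eq, abs_of_pos (by linarith)]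
      linarith
  · have hac' : a < c := lt_of_le_of_ne hac fun h => hPc (h ▸ h0)
    rcases exists_forwardJump_eq_or_left_dense hS hu hcS ha hac' with ⟨r, hr, har, hrc, hσ⟩ | h
    · exact hPc (hσ ▸ hscat r hr har (hrc.trans_le hcb) (by rw [hσ]; exact hrc) (hlt r hr har hrc))
    · exact hPc (hleft c hcS hac' hcb h hlt)

/-- A jump discards at most the point it leaves. Used contrapositively: with `n` points in `[a, b)`,
fewer than `n` jumps cannot reach `b`. -/
theorem encard_inter_Ico_le_of_iterate_forwardJump (k : ℕ) {a b : ℝ}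
    (h : b ≤ (forwardJump S)^[k] a) : (S ∩ Ico a b).encard ≤ k := by
  induction k generalizing a with
  | zero =>
    have h : b ≤ a := h
    rw [Ico_eq_empty (not_lt.2 h)]
    simp
  | succ k ih =>
    have hsub : S ∩ Ico a b ⊆ insert a (S ∩ Ico (forwardJump S a) b) := by
      rintro t ⟨htS, hat, htb⟩
      rcases hat.lt_or_eq with h' | h'
      · exact Or.inr ⟨htS, forwardJump_le htS h', htb⟩
      · exact Or.inl h'.symm
    refine (encard_le_encard hsub).trans ((encard_insert_le _ _).trans ?_)
    push_cast
    gcongr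
    exact ih h

/-- If `g` is continuous then `g ∘ σ` is rd-continuous. -/
theorem rdContinuousOn_comp_forwardJump {E : Type*} [TopologicalSpace E]
    (hu : ¬ BddAbove S) {g : ℝ → E} (hg : Continuous g) :
    RdContinuousOn S fun t => g (forwardJump S t) := by
  constructor
  · intro t ht h
    refine hg.continuousAt.tendsto.comp (x := 𝓝[S] t) (y := 𝓝 (forwardJump S t)) ?_
    rw [h]
    refine tendsto_order.2 ⟨fun c hc => ?_, fun c hc => ?_⟩
    · filter_upwards [mem_nhdsWithin_of_mem_nhds (Ioi_mem_nhds hc)] with s hs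
      exact lt_of_lt_of_le hs (le_forwardJump hu s)
    · obtain ⟨r, hr, htr, hrc⟩ := exists_mem_Ioo_of_forwardJump_eq hu h hc
      filter_upwards [mem_nhdsWithin_of_mem_nhds (Iio_mem_nhds htr)] with s hs
      exact (forwardJump_le hr hs).trans_lt hrc
  · intro t ht
    -- The left limit is `g t` even when `t` is right-scattered, because `s ≤ σ s ≤ t` for `s < t`.
    refine ⟨g t, hg.continuousAt.tendsto.comp (y := 𝓝 t) ?_⟩
    have hid : Tendsto (fun s : ℝ => s) (𝓝[S ∩ Iio t] t) (𝓝 t) :=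
      tendsto_id.mono_left nhdsWithin_le_nhds
    refine tendsto_of_tendsto_of_tendsto_of_le_of_le' hid tendsto_const_nhds
      (Eventually.of_forall fun s => le_forwardJump hu s) ?_
    filter_upwards [self_mem_nhdsWithin] with s hs
    exact forwardJump_le ht hs.2

end Jump

/-! ### Calculus of the delta derivative -/

section DeltaDerivative

variable {S : Set ℝ} {E F : Type*} [NormedAddCommGroup E] [NormedSpace ℝ E]
  [NormedAddCommGroup F] [NormedSpace ℝ F]

theorem HasDeltaDerivAt.add {f g : ℝ → E} {a b : E} {t : ℝ} (hf : HasDeltaDerivAt S f a t)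
    (hg : HasDeltaDerivAt S g b t) : HasDeltaDerivAt S (f + g) (a + b) t := by
  intro ε hε
  filter_upwards [hf (ε / 2) (by positivity), hg (ε / 2) (by positivity)] with s h1 h2
  calc _ = ‖(f (forwardJump S t) - f s - (forwardJump S t - s) • a) +
        (g (forwardJump S t) - g s - (forwardJump S t - s) • b)‖ := by
        simp only [Pi.add_apply, smul_add]; congr 1; abel
    _ ≤ _ := (norm_add_le _ _).trans (by linarith)

theorem HasDeltaDerivAt.clm_apply {f : ℝ → E} {a : E} {t : ℝ} (hf : HasDeltaDerivAt S f a t)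
    (L : E →L[ℝ] F) : HasDeltaDerivAt S (fun s => L (f s)) (L a) t := by
  intro ε hε
  filter_upwards [hf (ε / (‖L‖ + 1)) (by positivity)] with s h1
  rw [← map_sub, ← map_smul, ← map_sub]
  refine (L.le_opNorm _).trans ?_
  calc ‖L‖ * _ ≤ (‖L‖ + 1) * (ε / (‖L‖ + 1) * |forwardJump S t - s|) := by
        gcongr; linarith
    _ = _ := by field_simp

theorem HasDeltaDerivAt.congr_deriv {f : ℝ → E} {a b : E} {t : ℝ}
    (hf : HasDeltaDerivAt S f a t) (h : a = b) : HasDeltaDerivAt S f b t := h ▸ hf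

theorem HasDeltaDerivAt.sum {ι : Type*} (s : Finset ι) {f : ι → ℝ → E} {a : ι → E} {t : ℝ}
    (hf : ∀ i ∈ s, HasDeltaDerivAt S (f i) (a i) t) :
    HasDeltaDerivAt S (fun r => ∑ i ∈ s, f i r) (∑ i ∈ s, a i) t := by
  classical
  induction s using Finset.induction_on with
  | empty =>
    intro ε hε
    refine Eventually.of_forall fun s => ?_
    simp only [Finset.sum_empty, sub_self, smul_zero, norm_zero]
    positivity
  | insert i s hi ih =>
    simp only [Finset.sum_insert hi]
    exact (hf i (Finset.mem_insert_self i s)).add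
      (ih fun j hj => hf j (Finset.mem_insert_of_mem hj))

/-- The delta derivative of a product. -/
theorem HasDeltaDerivAt.mul {f g : ℝ → ℝ} {a b t : ℝ} (hf : HasDeltaDerivAt S f a t)
    (hg : HasDeltaDerivAt S g b t) (hgc : ContinuousAt g t) :
    HasDeltaDerivAt S (fun s => f s * g s) (f (forwardJump S t) * b + a * g t) t := by
  intro ε hε
  set σ := forwardJump S t
  have hb : ∀ᶠ s in 𝓝[S] t, |g s| < |g t| + 1 :=
    nhdsWithin_le_nhds ((hgc.abs).eventually (gt_mem_nhds (by linarith)))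
  have hn : ∀ᶠ s in 𝓝[S] t, |g s - g t| < ε / (3 * (|a| + 1)) := by
    have : Tendsto (fun s => |g s - g t|) (𝓝 t) (𝓝 |g t - g t|) := (hgc.sub continuousAt_const).abs
    rw [sub_self, abs_zero] at this
    exact nhdsWithin_le_nhds (this.eventually (gt_mem_nhds (by positivity)))
  filter_upwards [hf (ε / (3 * (|g t| + 1))) (by positivity),
    hg (ε / (3 * (|f σ| + 1))) (by positivity), hb, hn] with s h1 h2 h3 h4
  simp only [smul_eq_mul, Real.norm_eq_abs] at h1 h2 ⊢
  -- The first two terms are the errors of `g` and `f`; the third arises from having `g t` in place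
  -- of `g s`, and is where continuity of `g` enters.
  have e : f σ * g σ - f s * g s - (σ - s) * (f σ * b + a * g t) =
      f σ * (g σ - g s - (σ - s) * b) + (f σ - f s - (σ - s) * a) * g s
        + (σ - s) * a * (g s - g t) := by ring
  rw [e]
  refine (abs_add_le _ _).trans ?_
  refine (add_le_add_left (abs_add_le _ _) _).trans ?_
  rw [abs_mul, abs_mul, abs_mul, abs_mul]
  have k1 : |f σ| * |g σ - g s - (σ - s) * b| ≤ ε / 3 * |σ - s| := by
    calc _ ≤ (|f σ| + 1) * (ε / (3 * (|f σ| + 1)) * |σ - s|) := by gcongr; linarith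
      _ = _ := by field_simp
  have k2 : |f σ - f s - (σ - s) * a| * |g s| ≤ ε / 3 * |σ - s| := by
    calc _ ≤ (ε / (3 * (|g t| + 1)) * |σ - s|) * (|g t| + 1) := by gcongr
      _ = _ := by field_simp
  have k3 : |σ - s| * |a| * |g s - g t| ≤ ε / 3 * |σ - s| := by
    calc _ ≤ |σ - s| * (|a| + 1) * (ε / (3 * (|a| + 1))) := by gcongr; linarith
      _ = _ := by field_simp
  linarith

/-- Since `t ∈ S`, the defining inequality may be tested at `s = t`, where its left side does not
depend on `ε`. -/
theorem HasDeltaDerivAt.sub_eq_smul {f : ℝ → E} {a : E} {t : ℝ} (ht : t ∈ S)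
    (hf : HasDeltaDerivAt S f a t) :
    f (forwardJump S t) - f t = (forwardJump S t - t) • a := by
  refine sub_eq_zero.1 (norm_le_zero_iff.1 (le_of_forall_pos_le_add fun ε hε => ?_))
  have h := (hf (ε / (|forwardJump S t - t| + 1)) (by positivity)).self_of_nhdsWithin ht
  refine h.trans ?_
  rw [zero_add, div_mul_eq_mul_div, div_le_iff₀ (by positivity)]
  nlinarith [abs_nonneg (forwardJump S t - t)]

/-- A delta differentiable function is continuous along the time scale. -/
theorem HasDeltaDerivAt.continuousWithinAt {f : ℝ → E} {a : E} {t : ℝ} (ht : t ∈ S)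
    (hf : HasDeltaDerivAt S f a t) : ContinuousWithinAt f S t := by
  set σ := forwardJump S t
  have hst := hf.sub_eq_smul ht
  rw [ContinuousWithinAt, tendsto_iff_norm_sub_tendsto_zero]
  rw [Metric.tendsto_nhds]
  intro ε hε
  have hid : Tendsto (fun s : ℝ => s) (𝓝[S] t) (𝓝 t) := tendsto_id.mono_left nhdsWithin_le_nhds
  have h1 : Tendsto (fun s : ℝ => |t - s| * ‖a‖) (𝓝[S] t) (𝓝 (|t - t| * ‖a‖)) :=
    ((tendsto_const_nhds.sub hid).abs).mul_const _
  have h2 : Tendsto (fun s : ℝ => |σ - s|) (𝓝[S] t) (𝓝 |σ - t|) :=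
    (tendsto_const_nhds.sub hid).abs
  rw [sub_self, abs_zero, zero_mul] at h1
  filter_upwards [hf (ε / (2 * (|σ - t| + 1))) (by positivity),
    h1.eventually (gt_mem_nhds (half_pos hε)),
    h2.eventually (gt_mem_nhds (show |σ - t| < |σ - t| + 1 by linarith))] with s k1 k2 k3
  rw [Real.dist_eq, sub_zero, abs_norm]
  have e : f s - f t = (s - t) • a - (f σ - f s - (σ - s) • a) := by
    have : f σ = f t + (σ - t) • a := by rw [← hst]; abel
    rw [this]; module
  rw [e]
  refine (norm_sub_le _ _).trans_lt ?_
  rw [norm_smul, Real.norm_eq_abs, abs_sub_comm s t]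
  have : ε / (2 * (|σ - t| + 1)) * |σ - s| ≤ ε / 2 := by
    calc _ ≤ ε / (2 * (|σ - t| + 1)) * (|σ - t| + 1) := by gcongr
      _ = _ := by field_simp
  linarith

/-- A function that vanishes on `S ∩ [t, b]` has zero delta derivative at `t`. -/
theorem HasDeltaDerivAt.eq_zero_of_forall_eq_zero (hS : IsClosed S) (hu : ¬ BddAbove S)
    {f : ℝ → E} {a : E} {t b : ℝ} (ht : t ∈ S) (hb : b ∈ S) (htb : t < b)
    (hf : HasDeltaDerivAt S f a t) (h0 : ∀ s ∈ S, t ≤ s → s ≤ b → f s = 0) : a = 0 := by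
  have hσb : forwardJump S t ≤ b := forwardJump_le hb htb
  have hfσ : f (forwardJump S t) = 0 :=
    h0 _ (forwardJump_mem hS hu t) (le_forwardJump hu t) hσb
  rcases (le_forwardJump hu t).lt_or_eq with h | h
  · have := hf.sub_eq_smul ht
    rw [hfσ, h0 t ht le_rfl htb.le, sub_zero, eq_comm, smul_eq_zero] at this
    exact this.resolve_left (by linarith)
  · refine norm_le_zero_iff.1 (le_of_forall_pos_le_add fun ε hε => ?_)
    obtain ⟨δ, hδ, hball⟩ := Metric.mem_nhdsWithin_iff.1 (hf ε hε)
    obtain ⟨s, hs, hts, hsb⟩ := exists_mem_Ioo_of_forwardJump_eq hu h.symm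
      (show t < min b (t + δ) by rw [lt_min_iff]; constructor <;> linarith)
    rw [lt_min_iff] at hsb
    have := hball (show s ∈ Metric.ball t δ ∩ S from ⟨by
      rw [Metric.mem_ball, Real.dist_eq, abs_of_pos (by linarith)]; linarith [hsb.2], hs⟩)
    simp only [mem_ofPred_eq, h0 t ht le_rfl htb.le, h0 s hs hts.le hsb.1.le, neg_zero, zero_sub, norm_neg,
      norm_smul, Real.norm_eq_abs, ← h] at this
    have hpos : 0 < |t - s| := abs_pos.2 (by linarith)
    rw [mul_comm] at this
    linarith [le_of_mul_le_mul_right this hpos]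

/-- The slack `ε (t - a)` absorbs the error of the derivative at right-dense points, and continuity
carries the bound to left-dense ones. No derivative is needed at `b`, where the costate equation is
not available. -/
theorem monotoneOn_of_deltaDeriv_nonneg (hS : IsClosed S) (hu : ¬ BddAbove S) {f f' : ℝ → ℝ}
    {a b : ℝ} (ha : a ∈ S) (hc : ContinuousOn f S)
    (hf : ∀ t ∈ S, a ≤ t → t < b → HasDeltaDerivAt S f (f' t) t)
    (hf' : ∀ t ∈ S, a ≤ t → t < b → 0 ≤ f' t) :
    ∀ t ∈ S, a ≤ t → t ≤ b → f a ≤ f t := by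
  suffices H : ∀ ε > 0, ∀ t ∈ S, a ≤ t → t ≤ b → f a - ε * (t - a) ≤ f t by
    intro t ht hat htb
    refine le_of_forall_pos_le_add fun ε hε => ?_
    have h := H (ε / (t - a + 1)) (div_pos hε (by linarith)) t ht hat htb
    have : ε / (t - a + 1) * (t - a) ≤ ε := by
      rw [div_mul_eq_mul_div, div_le_iff₀ (by linarith)]; nlinarith
    linarith
  intro ε hε
  refine timeScale_induction hS hu (fun t => f a - ε * (t - a) ≤ f t) ha (by simp) ?_ ?_ ?_
  · intro t ht hat htb hσ hP
    have h1 := (hf t ht hat htb).sub_eq_smul ht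
    have h2 := mul_nonneg (sub_pos.2 hσ).le (hf' t ht hat htb)
    rw [smul_eq_mul] at h1
    nlinarith
  · intro t ht hat htb hσ hP
    filter_upwards [nhdsWithin_mono t inter_subset_left (hf t ht hat htb ε hε),
      self_mem_nhdsWithin] with s hs hs'
    have hts : t < s := hs'.2
    rw [hσ, smul_eq_mul, Real.norm_eq_abs, abs_sub_comm t s, abs_of_pos (sub_pos.2 hts)] at hs
    have h1 := (abs_le.1 hs).2
    have h2 := mul_nonneg (sub_pos.2 hts).le (hf' t ht hat htb)
    nlinarith
  · intro t ht hat htb hld hP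
    have hne : (𝓝[S ∩ Ico a t] t).NeBot := by
      refine mem_closure_iff_nhdsWithin_neBot.1 (Metric.mem_closure_iff.2 fun δ hδ => ?_)
      obtain ⟨s, hs, has, hcs, hst⟩ := hld (t - δ) (by linarith)
      exact ⟨s, ⟨hs, has, hst⟩, by rw [Real.dist_eq, abs_of_pos (by linarith)]; linarith⟩
    have hid : Tendsto (fun s : ℝ => s) (𝓝[S ∩ Ico a t] t) (𝓝 t) :=
      tendsto_id.mono_left nhdsWithin_le_nhds
    refine le_of_tendsto_of_tendsto
      (tendsto_const_nhds.sub (tendsto_const_nhds.mul (hid.sub_const a)))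
      ((hc t ht).mono_left (nhdsWithin_mono t inter_subset_left)) ?_
    filter_upwards [self_mem_nhdsWithin] with s hs using hP s hs.1 hs.2.1 hs.2.2

/-- A Grönwall type uniqueness statement. -/
theorem eq_zero_of_norm_deltaDeriv_le (hS : IsClosed S) (hu : ¬ BddAbove S) {f f' : ℝ → E}
    {a K : ℝ} (ha : a ∈ S) (h0 : f a = 0) (hK : 0 ≤ K)
    (hf : ∀ t ∈ S, a ≤ t → HasDeltaDerivAt S f (f' t) t)
    (hf' : ∀ t ∈ S, a ≤ t → ‖f' t‖ ≤ K * ‖f t‖) :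
    ∀ t ∈ S, a ≤ t → f t = 0 := by
  suffices H : ∀ ε > 0, ∀ b, ∀ t ∈ S, a ≤ t → t ≤ b →
      ‖f t‖ ≤ ε * Real.exp ((K + 1) * (t - a)) by
    intro t ht hat
    refine norm_le_zero_iff.1 (le_of_forall_pos_le_add fun ε hε => ?_)
    have h := H (ε / Real.exp ((K + 1) * (t - a))) (by positivity) t t ht hat le_rfl
    rwa [div_mul_cancel₀ _ (Real.exp_pos _).ne', ← zero_add ε] at h
  intro ε hε b
  -- The rate is `K + 1`: `K` bounds the growth of `f`, and the extra `1` pays for the error of the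
  -- derivative at right-dense points.
  have hexp : ∀ s t : ℝ, t ≤ s → ε * Real.exp ((K + 1) * (t - a)) * (1 + (s - t) * (K + 1)) ≤
      ε * Real.exp ((K + 1) * (s - a)) := fun s t hst => by
    have : (K + 1) * (s - a) = (K + 1) * (t - a) + (s - t) * (K + 1) := by ring
    rw [this, Real.exp_add, ← mul_assoc]
    gcongr
    linarith [Real.add_one_le_exp ((s - t) * (K + 1))]
  refine timeScale_induction hS hu (fun t => ‖f t‖ ≤ ε * Real.exp ((K + 1) * (t - a))) ha
    ?_ ?_ ?_ ?_
  · simp only [h0, norm_zero]; positivity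
  · intro t ht hat htb hσ hP
    have h1 : f (forwardJump S t) = f t + (forwardJump S t - t) • f' t := by
      rw [← (hf t ht hat).sub_eq_smul ht]; abel
    refine le_trans ?_ (hexp _ t hσ.le)
    rw [h1]
    refine (norm_add_le _ _).trans ?_
    rw [norm_smul, Real.norm_eq_abs, abs_of_pos (sub_pos.2 hσ)]
    have hd : 0 < forwardJump S t - t := sub_pos.2 hσ
    calc _ ≤ ‖f t‖ + (forwardJump S t - t) * (K * ‖f t‖) := by gcongr; exact hf' t ht hat
      _ = ‖f t‖ * (1 + (forwardJump S t - t) * K) := by ring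
      _ ≤ _ := by gcongr; linarith
  · intro t ht hat htb hσ hP
    filter_upwards [nhdsWithin_mono t inter_subset_left
      (hf t ht hat (ε * Real.exp ((K + 1) * (t - a))) (by positivity)),
      self_mem_nhdsWithin] with s hs hs'
    have hts : t < s := hs'.2
    have hd : 0 < s - t := sub_pos.2 hts
    rw [hσ, abs_sub_comm t s, abs_of_pos hd] at hs
    refine le_trans ?_ (hexp s t hts.le)
    have e : f s = f t + (s - t) • f' t - (f t - f s - (t - s) • f' t) := by module
    rw [e]
    refine (norm_sub_le _ _).trans ((add_le_add (norm_add_le _ _) hs).trans ?_)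
    rw [norm_smul, Real.norm_eq_abs, abs_of_pos hd]
    have := hf' t ht hat
    have h2 : (s - t) * ‖f' t‖ ≤ (s - t) * (K * (ε * Real.exp ((K + 1) * (t - a)))) := by
      gcongr; exact this.trans (by gcongr)
    nlinarith
  · intro t ht hat htb hld hP
    have hne : (𝓝[S ∩ Ico a t] t).NeBot := by
      refine mem_closure_iff_nhdsWithin_neBot.1 (Metric.mem_closure_iff.2 fun δ hδ => ?_)
      obtain ⟨s, hs, has, hcs, hst⟩ := hld (t - δ) (by linarith)
      exact ⟨s, ⟨hs, has, hst⟩, by rw [Real.dist_eq, abs_of_pos (by linarith)]; linarith⟩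
    have hexpc : Continuous fun s : ℝ => ε * Real.exp ((K + 1) * (s - a)) := by fun_prop
    refine le_of_tendsto_of_tendsto (b := 𝓝[S ∩ Ico a t] t)
      (((hf t ht hat.le).continuousWithinAt ht).norm.mono_left
        (nhdsWithin_mono t inter_subset_left))
      (hexpc.continuousAt.mono_left nhdsWithin_le_nhds) ?_
    filter_upwards [self_mem_nhdsWithin] with s hs using hP s hs.1 hs.2.1 hs.2.2

end DeltaDerivative

/-! ### Delayed linear Volterra equations -/

section Picard

variable {E : Type*} [NormedAddCommGroup E] [NormedSpace ℝ E]

/-- The Picard iterates of a delayed linear Volterra equation, frozen to the left of `a`. -/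
noncomputable def delayedPicard (L : E →L[ℝ] E) (θ : ℝ → ℝ) (a : ℝ) (g : ℝ → E) : ℕ → ℝ → E
  | 0 => fun t => g (max t a)
  | k + 1 => fun t => ∫ r in a..max t a, L (delayedPicard L θ a g k (θ r))

/-- The integrand may be discontinuous, but monotonicity of `θ` makes it measurable and keeps `θ r`
in a compact interval, where `L ∘ y` is bounded. -/
theorem intervalIntegrable_clm_comp_monotone (L : E →L[ℝ] E) {θ : ℝ → ℝ} (hθ : Monotone θ)
    {y : ℝ → E} (hy : Continuous y) (s t : ℝ) :
    IntervalIntegrable (fun r => L (y (θ r))) MeasureTheory.volume s t := by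
  obtain ⟨C, hC⟩ := (isCompact_Icc (a := θ (min s t)) (b := θ (max s t))).exists_bound_of_continuousOn
    (L.continuous.comp hy).continuousOn
  refine (intervalIntegrable_const (c := C)).mono_fun
    (((L.continuous.comp hy).comp_stronglyMeasurable
      hθ.measurable.stronglyMeasurable).aestronglyMeasurable) ?_
  refine (MeasureTheory.ae_restrict_iff' measurableSet_uIoc).2 (Eventually.of_forall fun r hr => ?_)
  exact (hC _ ⟨hθ hr.1.le, hθ hr.2⟩).trans (Real.le_norm_self C)

theorem continuous_delayedPicard (L : E →L[ℝ] E) {θ : ℝ → ℝ} (hθ : Monotone θ) (a : ℝ)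
    {g : ℝ → E} (hg : Continuous g) (k : ℕ) : Continuous (delayedPicard L θ a g k) := by
  induction k with
  | zero => exact hg.comp (continuous_id.max continuous_const)
  | succ k ih =>
    exact (intervalIntegral.continuous_primitive
      (intervalIntegrable_clm_comp_monotone L hθ ih) a).comp (continuous_id.max continuous_const)

/-- The factorial bound of the undelayed equation survives, because `θ r ≤ r` only consults earlier
times, where the bound is smaller. -/
theorem norm_delayedPicard_le (L : E →L[ℝ] E) {θ : ℝ → ℝ} (a : ℝ)
    (hθ : ∀ r, a ≤ r → θ r ≤ r) (g : ℝ → E) {b M : ℝ}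
    (hM : ∀ t ≤ b, ‖g (max t a)‖ ≤ M) (k : ℕ) :
    ∀ t ≤ b, ‖delayedPicard L θ a g k t‖ ≤ M * (‖L‖ * (max t a - a)) ^ k / k.factorial := by
  have hM0 : 0 ≤ M := (norm_nonneg _).trans (hM b le_rfl)
  induction k with
  | zero => intro t ht; simpa [delayedPicard] using hM t ht
  | succ k ih =>
    intro t ht
    rcases le_or_gt t a with hta | hta
    · simp [delayedPicard, max_eq_right hta]
    simp only [delayedPicard, max_eq_left hta.le]
    have hint : (∫ r in a..t, ‖L‖ * (M * (‖L‖ * (r - a)) ^ k / k.factorial)) =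
        M * (‖L‖ * (t - a)) ^ (k + 1) / (k + 1).factorial := by
      have : ∀ r, ‖L‖ * (M * (‖L‖ * (r - a)) ^ k / k.factorial) =
          (‖L‖ ^ (k + 1) * M / k.factorial) * (r - a) ^ k := fun r => by
        rw [mul_pow]; ring
      simp only [this]
      rw [intervalIntegral.integral_const_mul,
        intervalIntegral.integral_comp_sub_right (fun r => r ^ k), integral_pow, sub_self,
        Nat.factorial_succ, mul_pow]
      push_cast
      field_simp
      simp
    rw [← hint]
    refine intervalIntegral.norm_integral_le_of_norm_le hta.le
      (Eventually.of_forall fun r hr => ?_) (Continuous.intervalIntegrable (by fun_prop) _ _)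
    refine (L.le_opNorm _).trans ?_
    gcongr
    have h1 := hθ r hr.1.le
    refine (ih (θ r) (h1.trans (hr.2.trans ht))).trans ?_
    have h2 : max (θ r) a ≤ r := max_le h1 hr.1.le
    have h3 : 0 ≤ max (θ r) a - a := sub_nonneg.2 (le_max_right _ _)
    gcongr

/-- Existence for linear Volterra equations with a delay `θ r ≤ r`. -/
theorem exists_delayed_integral_solution [CompleteSpace E] (L : E →L[ℝ] E) {θ : ℝ → ℝ} (hθm : Monotone θ) {a : ℝ}
    (haθ : ∀ r, a ≤ θ r) (hθ : ∀ r, a ≤ r → θ r ≤ r) {f : ℝ → E}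
    (hf : ∀ s t, IntervalIntegrable f MeasureTheory.volume s t) (x₀ : E) :
    ∃ x : ℝ → E, Continuous x ∧
      (∀ s t, IntervalIntegrable (fun r => L (x (θ r)) + f r) MeasureTheory.volume s t) ∧
      ∀ t, x t = x₀ + ∫ r in a..t, (L (x (θ r)) + f r) := by
  set g : ℝ → E := fun t => x₀ + ∫ r in a..t, f r with hg
  have hgc : Continuous g := continuous_const.add (intervalIntegral.continuous_primitive hf a)
  set G := delayedPicard L θ a g with hG
  have hGc : ∀ k, Continuous (G k) := continuous_delayedPicard L hθm a hgc
  have hbound : ∀ b, ∃ u : ℕ → ℝ, Summable u ∧ ∀ k, ∀ t ≤ b, ‖G k t‖ ≤ u k := by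
    intro b
    obtain ⟨M, hM⟩ := (isCompact_Icc (a := a) (b := max b a)).exists_bound_of_continuousOn
      hgc.continuousOn
    have hM0 : 0 ≤ M := (norm_nonneg _).trans (hM a ⟨le_rfl, le_max_right _ _⟩)
    refine ⟨fun k => M * ((‖L‖ * (max b a - a)) ^ k / k.factorial),
      (Real.summable_pow_div_factorial _).mul_left M, fun k t ht => ?_⟩
    refine (norm_delayedPicard_le L a hθ g
      (fun t ht => hM _ ⟨le_max_right _ _, max_le_max_right a ht⟩) k t ht).trans ?_
    rw [mul_div_assoc]
    change _ ≤ M * ((‖L‖ * (max b a - a)) ^ k / k.factorial)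
    have h3 : 0 ≤ max t a - a := sub_nonneg.2 (le_max_right _ _)
    gcongr
  set y : ℝ → E := fun t => ∑' k, G k t with hy
  have hyc : Continuous y := by
    refine continuous_iff_continuousAt.2 fun t => ?_
    obtain ⟨u, hu, hGu⟩ := hbound (t + 1)
    exact (continuousOn_tsum (s := Iic (t + 1)) (fun k => (hGc k).continuousOn) hu
      fun k s hs => hGu k s hs).continuousAt (Iic_mem_nhds (by linarith))
  have hyL := intervalIntegrable_clm_comp_monotone L hθm hyc
  have hyeq : ∀ t, a ≤ t → y t = x₀ + ∫ r in a..t, (L (y (θ r)) + f r) := by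
    intro t ht
    obtain ⟨u, hu, hGu⟩ := hbound t
    have hsum : ∀ s ≤ t, HasSum (fun k => G k s) (y s) := fun s hs =>
      (Summable.of_norm_bounded hu fun k => hGu k s hs).hasSum
    have hint : HasSum (fun k => ∫ r in a..t, L (G k (θ r))) (∫ r in a..t, L (y (θ r))) := by
      refine intervalIntegral.hasSum_integral_of_dominated_convergence (fun k _ => ‖L‖ * u k)
        (fun k => ?_) (fun k => Eventually.of_forall fun r hr => ?_)
        (Eventually.of_forall fun r _ => hu.mul_left _) intervalIntegrable_const
        (Eventually.of_forall fun r hr => ?_)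
      · exact ((L.continuous.comp (hGc k)).comp_stronglyMeasurable
          hθm.measurable.stronglyMeasurable).aestronglyMeasurable
      · rw [uIoc_of_le ht] at hr
        refine (L.le_opNorm _).trans ?_
        gcongr
        exact hGu k _ ((hθ r hr.1.le).trans hr.2)
      · rw [uIoc_of_le ht] at hr
        exact L.hasSum (hsum _ ((hθ r hr.1.le).trans hr.2))
    have h0 := (hsum t le_rfl).tsum_eq
    rw [(hsum t le_rfl).summable.tsum_eq_zero_add] at h0
    rw [← h0, intervalIntegral.integral_add (hyL a t) (hf a t), ← hint.tsum_eq]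
    simp only [hG, delayedPicard, max_eq_left ht, hg]
    abel
  -- The series `y` solves the equation only for `t ≥ a`. The function returned is the right-hand
  -- side for all `t`; it agrees with `y` at every delayed time, since `θ ≥ a`.
  have hcongr : ∀ t, (∫ r in a..t, (L (y (θ r)) + f r)) =
      ∫ r in a..t, (L (x₀ + ∫ r' in a..θ r, (L (y (θ r')) + f r')) + f r) := fun t => by
    congr 1
    ext r
    rw [← hyeq _ (haθ r)]
  refine ⟨fun t => x₀ + ∫ r in a..t, (L (y (θ r)) + f r), ?_, ?_,
    fun t => congrArg (x₀ + ·) (hcongr t)⟩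
  · exact continuous_const.add (intervalIntegral.continuous_primitive
      (fun s t => (hyL s t).add (hf s t)) a)
  · intro s t
    have : (fun r => L (x₀ + ∫ r' in a..θ r, (L (y (θ r')) + f r')) + f r) =
        fun r => L (y (θ r)) + f r := by
      ext r
      rw [← hyeq _ (haθ r)]
    rw [this]
    exact (hyL s t).add (hf s t)

end Picard

/-! ### Existence of states and costates -/

section Existence

variable {E : Type*} [NormedAddCommGroup E] [NormedSpace ℝ E]

theorem isGreatest_sSup_inter_Iic {S : Set ℝ} (hS : IsClosed S) {a r : ℝ} (ha : a ∈ S)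
    (har : a ≤ r) : IsGreatest (S ∩ Iic r) (sSup (S ∩ Iic r)) :=
  (hS.inter isClosed_Iic).isGreatest_csSup ⟨a, ha, har⟩ ⟨r, fun _ h => h.2⟩

/-- A primitive is delta differentiable if its integrand is constant on the gap to the right of a
right-scattered point, and close to its limit near a right-dense point. -/
theorem hasDeltaDerivAt_of_integral [CompleteSpace E] {S : Set ℝ} (hu : ¬ BddAbove S)
    {y F : ℝ → E} (hyc : Continuous y)
    {t c : ℝ} {a : E} (htc : t < c)
    (hσc : forwardJump S t ≤ c) (hF : ∀ s r, IntervalIntegrable F MeasureTheory.volume s r)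
    (hy : ∀ s ∈ S, s ≤ c → ∀ r ∈ S, r ≤ c → y r - y s = ∫ q in s..r, F q)
    (ht : t ∈ S) (hσ : forwardJump S t ∈ S)
    (hscat : ∀ r, t < r → r < forwardJump S t → F r = a)
    (hdense : forwardJump S t = t → ∀ ε > 0, ∃ δ > 0, ∀ s ∈ S, |s - t| < δ →
      ∀ r, r ∈ uIoc s t → r ≠ t → r ≠ s → ‖F r - a‖ ≤ ε) : HasDeltaDerivAt S y a t := by
  intro ε hε
  rcases (le_forwardJump hu t).lt_or_eq with h | h
  · have hgap : y (forwardJump S t) - y t = (forwardJump S t - t) • a := by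
      rw [hy t ht htc.le _ hσ hσc, ← intervalIntegral.integral_const]
      refine intervalIntegral.integral_congr_Ioo_of_le h.le fun r hr => hscat r hr.1 hr.2
    -- At `s = t` the error is zero while the allowance `ε |σ t - t|` is positive, so the inequality
    -- persists near `t` by continuity.
    have hlim : Tendsto (fun s => ‖y (forwardJump S t) - y s - (forwardJump S t - s) • a‖ -
        ε * |forwardJump S t - s|) (𝓝 t) (𝓝 (‖y (forwardJump S t) - y t -
          (forwardJump S t - t) • a‖ - ε * |forwardJump S t - t|)) := by
      refine Continuous.tendsto (f := fun s => ‖y (forwardJump S t) - y s -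
        (forwardJump S t - s) • a‖ - ε * |forwardJump S t - s|) (by fun_prop) t
    rw [hgap, sub_self, norm_zero, zero_sub] at hlim
    have hneg : -(ε * |forwardJump S t - t|) < 0 :=
      neg_neg_of_pos (mul_pos hε (abs_pos.2 (by linarith)))
    filter_upwards [nhdsWithin_le_nhds (hlim.eventually (gt_mem_nhds hneg))] with s hs
    linarith
  · obtain ⟨δ, hδ, H⟩ := hdense h.symm ε hε
    rw [← h]
    filter_upwards [self_mem_nhdsWithin, nhdsWithin_le_nhds (Metric.ball_mem_nhds t hδ),
      nhdsWithin_le_nhds (Iio_mem_nhds htc)] with s hs hsδ hsc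
    rw [Metric.mem_ball, Real.dist_eq] at hsδ
    rw [hy s hs (le_of_lt hsc) t ht htc.le, ← intervalIntegral.integral_const,
      ← intervalIntegral.integral_sub (hF s t) intervalIntegrable_const]
    refine intervalIntegral.norm_integral_le_of_norm_le_const_ae ?_
    -- The endpoints, where the frozen time may leave the interval, form a null set.
    have hne : ∀ p : ℝ, ∀ᵐ r, r ≠ p := fun p => by
      simp [MeasureTheory.ae_iff]
    filter_upwards [hne t, hne s] with r h1 h2 hr
    exact H s hs hsδ r hr h1 h2

/-- The forward initial value problem `x^Δ = L x + g ∘ σ`. -/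
theorem exists_forward_solution [CompleteSpace E] {S : Set ℝ} (hS : IsClosed S)
    (hu : ¬ BddAbove S) {a : ℝ}
    (ha : IsLeast S a) (L : E →L[ℝ] E) {g : ℝ → E} (hg : Continuous g) (x₀ : E) :
    ∃ x : ℝ → E, Continuous x ∧ x a = x₀ ∧
      ∀ t ∈ S, HasDeltaDerivAt S x (L (x t) + g (forwardJump S t)) t := by
  -- `θ r` is the last point of `S` not after `r`. The integrand is then constant on each gap, which
  -- turns the Lebesgue integral into a delta integral.
  set θ : ℝ → ℝ := fun r => sSup (S ∩ Iic (max r a)) with hθdef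
  have hθ : ∀ r, IsGreatest (S ∩ Iic (max r a)) (θ r) := fun r =>
    isGreatest_sSup_inter_Iic hS ha.1 (le_max_right r a)
  have hθm : Monotone θ := fun r s hrs =>
    (hθ s).2 ⟨(hθ r).1.1, (mem_Iic.1 (hθ r).1.2).trans (max_le_max_right a hrs)⟩
  have haθ : ∀ r, a ≤ θ r := fun r => ha.2 (hθ r).1.1
  have hθle : ∀ r, a ≤ r → θ r ≤ r := fun r hr => (hθ r).1.2.trans (max_le le_rfl hr)
  have hleθ : ∀ s ∈ S, ∀ r, s ≤ r → s ≤ θ r := fun s hs r hsr =>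
    (hθ r).2 ⟨hs, hsr.trans (le_max_left _ _)⟩
  obtain ⟨x, hxc, hxi, hx⟩ := exists_delayed_integral_solution L hθm haθ hθle
    (f := fun r => g (forwardJump S (θ r)))
    (intervalIntegrable_clm_comp_monotone (ContinuousLinearMap.id ℝ E)
      ((forwardJump_mono hu).comp hθm) hg) x₀
  refine ⟨x, hxc, by rw [hx, intervalIntegral.integral_same, add_zero], fun t ht => ?_⟩
  have hat := ha.2 ht
  have hxt : ContinuousAt (fun p : ℝ × ℝ => L (x p.1) + g p.2) (t, t) :=
    Continuous.continuousAt (by fun_prop)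
  refine hasDeltaDerivAt_of_integral hu hxc (c := max (t + 1) (forwardJump S t))
    (lt_max_of_lt_left (lt_add_one t)) (le_max_right _ _) hxi (fun s _ _ r _ _ => ?_) ht
    (forwardJump_mem hS hu t) (fun r htr hr => ?_) (fun h ε hε => ?_)
  · rw [hx s, hx r, add_sub_add_left_eq_sub,
      intervalIntegral.integral_interval_sub_left (hxi _ _) (hxi _ _)]
  · have : θ r = t := le_antisymm (by
      by_contra! hlt
      exact absurd (forwardJump_le (hθ r).1.1 hlt)
        (not_le.2 ((hθle r (hat.trans htr.le)).trans_lt hr))) (hleθ t ht r htr.le)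
    rw [this]
  · obtain ⟨δ, hδ, H⟩ := Metric.continuousAt_iff.1 hxt ε hε
    refine ⟨δ, hδ, fun s hs hsδ r hr hrt hrs => ?_⟩
    have hmem : θ r ∈ uIcc s t ∧ forwardJump S (θ r) ∈ uIcc s t := by
      rcases le_total s t with hst | hst
      · rw [uIoc_of_le hst] at hr
        rw [uIcc_of_le hst]
        have h1 := hleθ s hs r hr.1.le
        have h2 : θ r < t :=
          (hθle r ((ha.2 hs).trans hr.1.le)).trans_lt (lt_of_le_of_ne hr.2 hrt)
        exact ⟨⟨h1, h2.le⟩, h1.trans (le_forwardJump hu _), forwardJump_le ht h2⟩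
      · rw [uIoc_of_ge hst] at hr
        rw [uIcc_of_ge hst]
        have h1 := hleθ t ht r hr.1.le
        have h2 : θ r < s :=
          (hθle r (hat.trans hr.1.le)).trans_lt (lt_of_le_of_ne hr.2 hrs)
        exact ⟨⟨h1, h2.le⟩, h1.trans (le_forwardJump hu _), forwardJump_le hs h2⟩
    have hd : ∀ p ∈ uIcc s t, dist p t < δ := fun p hp =>
      dist_comm p t ▸ (abs_sub_right_of_mem_uIcc hp).trans_lt (by rwa [abs_sub_comm])
    have := H (x := (θ r, forwardJump S (θ r))) (by
      rw [Prod.dist_eq]; exact max_lt (hd _ hmem.1) (hd _ hmem.2))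
    rw [dist_eq_norm] at this
    rw [h]
    exact this.le

/-- The backward terminal value problem for the adjoint equation `v^Δ = -L (v ∘ σ)`. -/
theorem exists_backward_solution [CompleteSpace E] {S : Set ℝ} (hS : IsClosed S)
    (hu : ¬ BddAbove S) {b : ℝ}
    (hb : b ∈ S) (L : E →L[ℝ] E) (q : E) :
    ∃ v : ℝ → E, Continuous v ∧ v b = q ∧
      ∀ t ∈ S, t < b → HasDeltaDerivAt S v (-L (v (forwardJump S t))) t := by
  -- Time reversal makes the terminal condition an initial one. For `r ≤ b`, `-θ (-r)` is the first
  -- point of `S` not before `r`; inside a gap this is the forward jump, whence `v ∘ σ` in the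
  -- equation.
  set θ : ℝ → ℝ := fun r => sSup ((-S) ∩ Iic (max r (-b))) with hθdef
  have hnS : IsClosed (-S) := hS.neg
  have hθ : ∀ r, IsGreatest ((-S) ∩ Iic (max r (-b))) (θ r) := fun r =>
    isGreatest_sSup_inter_Iic hnS (a := -b) (by simpa using hb) (le_max_right r _)
  have hθm : Monotone θ := fun r s hrs =>
    (hθ s).2 ⟨(hθ r).1.1, (mem_Iic.1 (hθ r).1.2).trans (max_le_max_right _ hrs)⟩
  have hbθ : ∀ r, -b ≤ θ r := fun r => (hθ r).2 ⟨by simpa using hb, mem_Iic.2 (le_max_right _ _)⟩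
  have hθle : ∀ r, -b ≤ r → θ r ≤ r := fun r hr => (hθ r).1.2.trans (max_le le_rfl hr)
  obtain ⟨x, hxc, hxi, hx⟩ := exists_delayed_integral_solution L hθm hbθ hθle
    (f := fun _ => 0) (fun _ _ => intervalIntegrable_const) q
  simp only [add_zero] at hx hxi
  have hnext : ∀ r, -θ (-r) ∈ S := fun r => (hθ (-r)).1.1
  have hnextle : ∀ s ∈ S, ∀ r, r ≤ s → -θ (-r) ≤ s := fun s hs r hrs => by
    have := (hθ (-r)).2 (show -s ∈ (-S) ∩ Iic (max (-r) (-b)) from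
      ⟨by simpa using hs, le_max_of_le_left (neg_le_neg hrs)⟩)
    linarith
  have hlenext : ∀ r ≤ b, r ≤ -θ (-r) := fun r hr => by
    linarith [hθle (-r) (neg_le_neg hr)]
  set F : ℝ → E := fun r => -L (x (θ (-r))) with hF
  have hFi : ∀ s r, IntervalIntegrable F MeasureTheory.volume s r := fun s r => by
    have hm : Monotone fun r => -θ (-r) := fun r r' h => neg_le_neg (hθm (neg_le_neg h))
    simpa [hF] using intervalIntegrable_clm_comp_monotone (-L) hm (hxc.comp continuous_neg) s r
  refine ⟨fun t => x (-t), hxc.comp continuous_neg, ?_, fun t ht htb => ?_⟩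
  · change x (-b) = q
    rw [hx, intervalIntegral.integral_same, add_zero]
  have hσb := forwardJump_le hb htb
  have hσS := forwardJump_mem hS hu t
  refine hasDeltaDerivAt_of_integral hu (hxc.comp continuous_neg) htb hσb hFi
    (fun s _ _ r _ _ => ?_) ht hσS (fun r htr hr => ?_) (fun h ε hε => ?_)
  · change x (-r) - x (-s) = _
    rw [hx (-s), hx (-r), add_sub_add_left_eq_sub,
      intervalIntegral.integral_interval_sub_left (hxi _ _) (hxi _ _), hF,
      intervalIntegral.integral_neg, intervalIntegral.integral_comp_neg
        (fun r => L (x (θ r))), ← intervalIntegral.integral_symm]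
  · have h1 : -θ (-r) = forwardJump S t := le_antisymm (hnextle _ hσS r hr.le)
      (forwardJump_le (hnext r) (htr.trans_le (hlenext r (hr.le.trans hσb))))
    simp only [hF, ← h1, neg_neg]
  · have hxt : ContinuousAt (fun r : ℝ => -L (x (-r))) t :=
      Continuous.continuousAt (by fun_prop)
    obtain ⟨δ, hδ, H⟩ := Metric.continuousAt_iff.1 hxt ε hε
    refine ⟨min δ (b - t), lt_min hδ (by linarith), fun s hs hsδ r hr hrt hrs => ?_⟩
    rw [lt_min_iff] at hsδ
    have hsb : s ≤ b := by linarith [(abs_lt.1 hsδ.2).2]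
    have hmem : -θ (-r) ∈ uIcc s t := by
      rcases le_total s t with hst | hst
      · rw [uIoc_of_le hst] at hr
        rw [uIcc_of_le hst]
        exact ⟨hr.1.le.trans (hlenext r (hr.2.trans htb.le)), hnextle t ht r hr.2⟩
      · rw [uIoc_of_ge hst] at hr
        rw [uIcc_of_ge hst]
        exact ⟨hr.1.le.trans (hlenext r (hr.2.trans hsb)), hnextle s hs r hr.2⟩
    have := H (x := -θ (-r)) (dist_comm (-θ (-r)) t ▸ (abs_sub_right_of_mem_uIcc hmem).trans_lt
      (by rw [abs_sub_comm]; exact hsδ.1))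
    rw [dist_eq_norm, neg_neg] at this
    simp only [h]
    exact this.le

end Existence

/-! ### The Popov-Belevitch-Hautus conditions and the Kalman matrix -/

section LinearAlgebra

open Matrix

/-- Full row rank means trivial left kernel, and the two blocks of `p ᵥ* M = 0` are the two
equations on `p`. -/
theorem pbhRankCondition_iff_pbhEigenvectorCondition {n m : ℕ} (A : Matrix (Fin n) (Fin n) ℝ)
    (B : Matrix (Fin n) (Fin m) ℝ) : PBHRankCondition A B ↔ PBHEigenvectorCondition A B := by
  unfold PBHRankCondition PBHEigenvectorCondition
  refine forall_congr' fun z => ?_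
  set M := Matrix.fromCols (z • (1 : Matrix (Fin n) (Fin n) ℂ) - A.map Complex.ofReal)
    (B.map Complex.ofReal) with hM
  have h1 : M.rank = n ↔ LinearIndependent ℂ M.row := by
    rw [linearIndependent_iff_card_eq_finrank_span, Matrix.rank_eq_finrank_span_row,
      Fintype.card_fin, eq_comm]
    rfl
  rw [h1, ← Matrix.vecMul_injective_iff,
    show (fun v => v ᵥ* M) = ⇑M.vecMulLinear from rfl, injective_iff_map_eq_zero]
  refine forall_congr' fun p => ?_
  rw [Matrix.vecMulLinear_apply, hM, Matrix.vecMul_fromCols, Matrix.vecMul_sub,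
    Matrix.vecMul_smul, Matrix.vecMul_one]
  constructor
  · intro h h2 h3
    refine h ?_
    rw [h2, h3, sub_self]
    ext (i | i) <;> rfl
  · intro h h2
    refine h ?_ ?_
    · ext i
      have := congrFun h2 (Sum.inl i)
      simp only [Sum.elim_inl, Pi.zero_apply, Pi.sub_apply] at this
      exact (sub_eq_zero.1 this).symm
    · ext i
      exact congrFun h2 (Sum.inr i)

/-- A vector annihilating the Kalman matrix annihilates `A ^ k * B` for all `k`. -/
theorem vecMul_pow_mul_eq_zero {n m : ℕ} {A : Matrix (Fin n) (Fin n) ℝ}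
    {B : Matrix (Fin n) (Fin m) ℝ} {q : Fin n → ℝ}
    (hq : ∀ j < n, q ᵥ* (A ^ j * B) = 0) (k : ℕ) : q ᵥ* (A ^ k * B) = 0 := by
  have hmem : ∀ p : Polynomial ℝ, p.degree < n → q ᵥ* (Polynomial.aeval A p * B) = 0 := by
    intro p hp
    -- The bound `n + 1` covers `n = 0`, where `natDegree 0 < n` fails; the coefficient of index `n`
    -- is zero anyway.
    rw [Polynomial.aeval_eq_sum_range' (n := n + 1)
      (by have := Polynomial.natDegree_le_of_degree_le hp.le; omega)]
    rw [Matrix.sum_mul, Matrix.vecMul_sum]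
    refine Finset.sum_eq_zero fun j hj => ?_
    rw [Matrix.smul_mul, Matrix.vecMul_smul]
    rcases Nat.lt_or_ge j n with h | h
    · rw [hq j h, smul_zero]
    · rw [Polynomial.coeff_eq_zero_of_degree_lt (hp.trans_le (by exact_mod_cast h)), zero_smul]
  -- Cayley-Hamilton: `A ^ k` is a polynomial in `A` of degree below `n`.
  rw [Matrix.pow_eq_aeval_mod_charpoly]
  refine hmem _ ?_
  have := Polynomial.degree_modByMonic_lt (Polynomial.X ^ k) A.charpoly_monic
  rwa [Matrix.charpoly_degree_eq_dim, Fintype.card_fin] at this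

/-- The common left kernel of all `A ^ k * B` is invariant under `p ↦ pᵀA`. If nonzero over `ℂ`, it
contains a left eigenvector, which `B` annihilates (`k = 0`). -/
theorem eq_zero_of_pbhEigenvectorCondition {n m : ℕ} {A : Matrix (Fin n) (Fin n) ℝ}
    {B : Matrix (Fin n) (Fin m) ℝ} (h : PBHEigenvectorCondition A B) {q : Fin n → ℝ}
    (hq : ∀ k, q ᵥ* (A ^ k * B) = 0) : q = 0 := by
  set A' : Matrix (Fin n) (Fin n) ℂ := A.map Complex.ofRealHom with hA'
  set B' : Matrix (Fin n) (Fin m) ℂ := B.map Complex.ofRealHom with hB'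
  let N : Submodule ℂ (Fin n → ℂ) := ⨅ k : ℕ, LinearMap.ker (A' ^ k * B').vecMulLinear
  have hN : ∀ p, p ∈ N ↔ ∀ k, p ᵥ* (A' ^ k * B') = 0 := fun p => by
    simp only [N, Submodule.mem_iInf, LinearMap.mem_ker, Matrix.vecMulLinear_apply]
  have hinv : ∀ p ∈ N, A'.vecMulLinear p ∈ N := fun p hp => by
    rw [hN] at hp ⊢
    intro k
    rw [Matrix.vecMulLinear_apply, Matrix.vecMul_vecMul, ← Matrix.mul_assoc, ← pow_succ']
    exact hp (k + 1)
  have hbot : N = ⊥ := by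
    by_contra hne
    have : Nontrivial N := Submodule.nontrivial_iff_ne_bot.2 hne
    obtain ⟨μ, hμ⟩ := Module.End.exists_eigenvalue (A'.vecMulLinear.restrict hinv)
    obtain ⟨v, hv⟩ := hμ.exists_hasEigenvector
    refine hv.2 (Subtype.ext (h μ v ?_ ?_))
    · exact congrArg Subtype.val hv.apply_eq_smul
    · have := (hN v).1 v.2 0
      rwa [pow_zero, Matrix.one_mul] at this
  have hqN : (Complex.ofRealHom ∘ q : Fin n → ℂ) ∈ N := by
    rw [hN]
    intro k
    have : A' ^ k * B' = (A ^ k * B).map Complex.ofRealHom := by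
      rw [Matrix.map_mul, Matrix.map_pow]
    ext i
    rw [this, ← RingHom.map_vecMul, hq k]
    simp
  rw [hbot, Submodule.mem_bot] at hqN
  ext i
  exact Complex.ofReal_eq_zero.1 (congrFun hqN i)

end LinearAlgebra

/-! ### Reachability, duality and the costate -/

section Control

open Matrix

variable {n m : ℕ} {T : Set ℝ} {A : Matrix (Fin n) (Fin n) ℝ} {B : Matrix (Fin n) (Fin m) ℝ}

theorem IsStateSolution.add {u u' : ℝ → Fin m → ℝ} {t₀ : ℝ} {x₀ x₀' : Fin n → ℝ}
    {x x' : ℝ → Fin n → ℝ} (h : IsStateSolution T A B u t₀ x₀ x)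
    (h' : IsStateSolution T A B u' t₀ x₀' x') :
    IsStateSolution T A B (u + u') t₀ (x₀ + x₀') (x + x') := by
  refine ⟨by rw [Pi.add_apply, h.1, h'.1], fun t ht => ?_⟩
  refine ((h.2 t ht).add (h'.2 t ht)).congr_deriv ?_
  simp only [Pi.add_apply, Matrix.mulVec_add]
  abel

theorem IsStateSolution.smul {u : ℝ → Fin m → ℝ} {t₀ : ℝ} {x₀ : Fin n → ℝ}
    {x : ℝ → Fin n → ℝ} (h : IsStateSolution T A B u t₀ x₀ x) (c : ℝ) :
    IsStateSolution T A B (c • u) t₀ (c • x₀) (c • x) := by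
  refine ⟨by rw [Pi.smul_apply, h.1], fun t ht => ?_⟩
  refine ((h.2 t ht).clm_apply (c • ContinuousLinearMap.id ℝ _)).congr_deriv ?_
  simp [Matrix.mulVec_smul]

theorem isClosed_inter_Ici (hT : IsClosed T) (a : ℝ) : IsClosed (T ∩ Ici a) :=
  hT.inter isClosed_Ici

theorem not_bddAbove_inter_Ici (hu : ¬ BddAbove T) (a : ℝ) : ¬ BddAbove (T ∩ Ici a) := by
  rw [not_bddAbove_iff]
  intro x
  obtain ⟨s, hs, h⟩ := not_bddAbove_iff.1 hu (max x a)
  exact ⟨s, ⟨hs, (le_max_right x a).trans h.le⟩, (le_max_left x a).trans_lt h⟩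

/-- Every input `w ∘ σ` with `w` continuous has a state trajectory. -/
theorem exists_isStateSolution (hT : IsClosed T) (hu : ¬ BddAbove T)
    (A : Matrix (Fin n) (Fin n) ℝ) (B : Matrix (Fin n) (Fin m) ℝ) {t₀ : ℝ} (ht₀ : t₀ ∈ T)
    {w : ℝ → Fin m → ℝ} (hw : Continuous w) (x₀ : Fin n → ℝ) :
    ∃ x, Continuous x ∧ IsStateSolution T A B (fun t => w (forwardJump T t)) t₀ x₀ x := by
  obtain ⟨x, hxc, hx0, hx⟩ := exists_forward_solution (isClosed_inter_Ici hT t₀)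
    (not_bddAbove_inter_Ici hu t₀) (a := t₀) ⟨⟨ht₀, mem_Ici.2 le_rfl⟩, fun s hs => hs.2⟩
    (LinearMap.toContinuousLinearMap A.mulVecLin) (g := fun t => B *ᵥ w t)
    (Continuous.matrix_mulVec continuous_const hw) x₀
  refine ⟨x, hxc, hx0, fun t ht => (hx t ht).congr_deriv ?_⟩
  rw [forwardJump_inter_Ici T ht.2]
  rfl

/-- The states reachable from the origin at time `tf` by inputs `w ∘ σ`, `w` continuous. -/
def reachableSubmodule (T : Set ℝ) (A : Matrix (Fin n) (Fin n) ℝ) (B : Matrix (Fin n) (Fin m) ℝ)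
    (t₀ tf : ℝ) : Submodule ℝ (Fin n → ℝ) where
  carrier := {y | ∃ w : ℝ → Fin m → ℝ, Continuous w ∧ ∃ x,
    IsStateSolution T A B (fun t => w (forwardJump T t)) t₀ 0 x ∧ x tf = y}
  add_mem' := by
    rintro _ _ ⟨w, hw, x, hx, rfl⟩ ⟨w', hw', x', hx', rfl⟩
    refine ⟨w + w', hw.add hw', x + x', ?_, rfl⟩
    have := hx.add hx'
    rwa [add_zero] at this
  zero_mem' := by
    refine ⟨0, continuous_const, 0, ⟨rfl, fun t ht ε hε => Eventually.of_forall fun s => ?_⟩, rfl⟩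
    simp only [Pi.zero_apply, Matrix.mulVec_zero, add_zero, smul_zero, sub_self, norm_zero]
    positivity
  smul_mem' := by
    rintro c _ ⟨w, hw, x, hx, rfl⟩
    refine ⟨c • w, hw.const_smul c, c • x, ?_, rfl⟩
    have := hx.smul c
    rwa [smul_zero] at this

/-- Superposition: the unforced motion from `x₀` is corrected by a trajectory from the origin. -/
theorem isControllableOn_of_reachableSubmodule_eq_top (hT : IsClosed T) (hu : ¬ BddAbove T)
    {t₀ tf : ℝ} (ht₀ : t₀ ∈ T) (h : reachableSubmodule T A B t₀ tf = ⊤) :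
    IsControllableOn T A B t₀ tf := by
  intro x₀ xf
  obtain ⟨x, -, hx⟩ := exists_isStateSolution hT hu A B ht₀ (w := 0) continuous_const x₀
  obtain ⟨w, hw, x', hx', hxf⟩ : xf - x tf ∈ reachableSubmodule T A B t₀ tf := h ▸ trivial
  refine ⟨fun t => w (forwardJump T t), rdContinuousOn_comp_forwardJump hu hw, x + x', ?_, ?_⟩
  · have := hx.add hx'
    rw [add_zero] at this
    convert this using 1
    ext t i
    simp
  · rw [Pi.add_apply, hxf]; abel

theorem pbhEigenvectorCondition_of_isControllableOn (hT : IsClosed T) (hu : ¬ BddAbove T)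
    {t₀ tf : ℝ} (ht₀ : t₀ ∈ T) (htf : tf ∈ T) (h0f : t₀ < tf)
    (h : IsControllableOn T A B t₀ tf) : PBHEigenvectorCondition A B := by
  intro lam p hpA hpB
  let ℓ : (Fin n → ℝ) →ₗ[ℝ] ℂ :=
    { toFun := fun y => p ⬝ᵥ fun i => (y i : ℂ)
      map_add' := fun y z => by simp [dotProduct, mul_add, Finset.sum_add_distrib]
      map_smul' := fun c y => by
        simp only [dotProduct, Pi.smul_apply, smul_eq_mul, Complex.ofReal_mul, RingHom.id_apply,
          Complex.real_smul, Finset.mul_sum]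
        exact Finset.sum_congr rfl fun i _ => by ring }
  have hℓ : ∀ y, ℓ y = p ⬝ᵥ fun i => (y i : ℂ) := fun y => rfl
  have hcast : ∀ {k : ℕ} (M : Matrix (Fin n) (Fin k) ℝ) (y : Fin k → ℝ),
      ℓ (M *ᵥ y) = (p ᵥ* M.map Complex.ofReal) ⬝ᵥ fun i => (y i : ℂ) := fun M y => by
    rw [hℓ, ← Matrix.dotProduct_mulVec]
    congr 1
    ext i
    simp [Matrix.mulVec, dotProduct]
  ext i
  -- Steering from `0` to the `i`-th basis vector makes `ℓ (x tf)` the coordinate `p i`.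
  obtain ⟨u, -, x, hx, hxf⟩ := h 0 (Pi.single i 1)
  have hz := eq_zero_of_norm_deltaDeriv_le (isClosed_inter_Ici hT t₀)
    (not_bddAbove_inter_Ici hu t₀) (f := fun t => ℓ (x t)) (f' := fun t => lam * ℓ (x t))
    (a := t₀) (K := ‖lam‖) ⟨ht₀, mem_Ici.2 le_rfl⟩ (by rw [hx.1, map_zero]) (norm_nonneg _)
    (fun t ht _ => ((hx.2 t ht).clm_apply (LinearMap.toContinuousLinearMap ℓ)).congr_deriv (by
      rw [LinearMap.coe_toContinuousLinearMap', map_add, hcast, hcast, hpA, hpB, zero_dotProduct,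
        add_zero, smul_dotProduct, smul_eq_mul, hℓ]))
    (fun t _ _ => (norm_mul _ _).le) tf ⟨htf, h0f.le⟩ h0f.le
  simp only [hxf, hℓ] at hz
  rw [Pi.zero_apply, ← hz]
  simp [dotProduct, Pi.single_apply, apply_ite Complex.ofReal]

/-- If `v^Δ = -v^σ A` and `v^σ C` vanishes on `[s, tf)`, then `v C` vanishes on `(s, tf]`. -/
theorem vecMul_eq_zero_of_forall_forwardJump (hT : IsClosed T) (hu : ¬ BddAbove T)
    {v : ℝ → Fin n → ℝ} (hv : Continuous v) {k : ℕ} (C : Matrix (Fin n) (Fin k) ℝ) {s tf : ℝ}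
    (hs : s ∈ T) (h : ∀ t ∈ T, s ≤ t → t < tf → v (forwardJump T t) ᵥ* C = 0) :
    ∀ t ∈ T, s < t → t ≤ tf → v t ᵥ* C = 0 := by
  intro t ht hst htf
  rcases exists_forwardJump_eq_or_left_dense hT hu ht hs hst with ⟨r, hr, hsr, hrt, hσ⟩ | hd
  · rw [← hσ]
    exact h r hr hsr (hrt.trans_le htf)
  · have hcl : IsClosed {r | v r ᵥ* C = 0} :=
      isClosed_eq (Continuous.matrix_vecMul hv continuous_const) continuous_const
    refine hcl.closure_subset (Metric.mem_closure_iff.2 fun δ hδ => ?_)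
    obtain ⟨r, hr, hsr, hδr, hrt⟩ := hd (t - δ) (by linarith)
    refine ⟨forwardJump T r, h r hr hsr (hrt.trans_le htf), ?_⟩
    have h1 := le_forwardJump hu r
    have h2 := forwardJump_le ht hrt
    rw [Real.dist_eq, abs_of_nonneg (by linarith)]
    linarith

/-- `v C` vanishes on `(s, tf]`, hence so does its derivative `-v^σ A C` before `tf`. The point `s`
itself may be lost if it is right-scattered, so the conclusion starts at `σ s`. -/
theorem vecMul_mul_eq_zero_of_forall_forwardJump (hT : IsClosed T) (hu : ¬ BddAbove T)
    {v : ℝ → Fin n → ℝ} (hv : Continuous v) {tf : ℝ} (htf : tf ∈ T)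
    (hvd : ∀ t ∈ T, t < tf → HasDeltaDerivAt T v (-(v (forwardJump T t) ᵥ* A)) t) {k : ℕ}
    (C : Matrix (Fin n) (Fin k) ℝ) {s : ℝ} (hs : s ∈ T)
    (h : ∀ t ∈ T, s ≤ t → t < tf → v (forwardJump T t) ᵥ* C = 0) :
    ∀ t ∈ T, forwardJump T s ≤ t → t < tf → v (forwardJump T t) ᵥ* (A * C) = 0 := by
  have hC := vecMul_eq_zero_of_forall_forwardJump hT hu hv C hs h
  intro t ht hst httf
  have hst' : s ≤ t := (le_forwardJump hu s).trans hst
  have hzero : ∀ r ∈ T, t ≤ r → r ≤ tf → v r ᵥ* C = 0 := fun r hr htr hrf => by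
    -- The case `r = s` occurs only if `σ s = s`, and then the hypothesis at `s` already concerns `v
    -- s`.
    rcases (hst'.trans htr).lt_or_eq with hlt | heq
    · exact hC r hr hlt hrf
    · have hrt : r = t := le_antisymm (heq ▸ hst') htr
      have hσ : forwardJump T r = r := by
        have hle := hst.trans htr
        rw [heq] at hle
        exact le_antisymm hle (le_forwardJump hu r)
      have := h r hr heq.le (hrt ▸ httf)
      rwa [hσ] at this
  have hd := (hvd t ht httf).clm_apply (LinearMap.toContinuousLinearMap C.vecMulLinear)
  have := hd.eq_zero_of_forall_eq_zero hT hu ht htf httf hzero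
  rwa [LinearMap.coe_toContinuousLinearMap', Matrix.vecMulLinear_apply, Matrix.neg_vecMul,
    neg_eq_zero, Matrix.vecMul_vecMul] at this

theorem HasDeltaDerivAt.mono {E : Type*} [NormedAddCommGroup E] [NormedSpace ℝ E] {f : ℝ → E}
    {a : E} {t t₀ : ℝ} (h : HasDeltaDerivAt T f a t) (ht : t₀ ≤ t) :
    HasDeltaDerivAt (T ∩ Ici t₀) f a t := by
  intro ε hε
  rw [forwardJump_inter_Ici T ht]
  exact nhdsWithin_mono t inter_subset_left (h ε hε)

theorem HasDeltaDerivAt.dotProduct {S : Set ℝ} {f g : ℝ → Fin n → ℝ} {a b : Fin n → ℝ} {t : ℝ}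
    (hf : HasDeltaDerivAt S f a t) (hg : HasDeltaDerivAt S g b t) (hgc : ContinuousAt g t) :
    HasDeltaDerivAt S (fun s => f s ⬝ᵥ g s) (f (forwardJump S t) ⬝ᵥ b + a ⬝ᵥ g t) t := by
  have := HasDeltaDerivAt.sum (S := S) (t := t) Finset.univ (f := fun i s => f s i * g s i)
    fun i _ => (hf.clm_apply (ContinuousLinearMap.proj i)).mul
      (hg.clm_apply (ContinuousLinearMap.proj i)) ((continuous_apply i).continuousAt.comp hgc)
  refine this.congr_deriv ?_
  simp [_root_.dotProduct, Finset.sum_add_distrib]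

/-- A costate whose terminal value is orthogonal to the reachable states satisfies `v^σ B = 0`. -/
theorem vecMul_eq_zero_of_orthogonal_reachable (hT : IsClosed T) (hu : ¬ BddAbove T)
    {t₀ tf : ℝ} (ht₀ : t₀ ∈ T) (htf : tf ∈ T) (h0f : t₀ < tf)
    {v : ℝ → Fin n → ℝ} (hv : Continuous v)
    (hvd : ∀ t ∈ T, t < tf → HasDeltaDerivAt T v (-(v (forwardJump T t) ᵥ* A)) t)
    (horth : ∀ y ∈ reachableSubmodule T A B t₀ tf, v tf ⬝ᵥ y = 0) :
    ∀ t ∈ T, t₀ ≤ t → t < tf → v (forwardJump T t) ᵥ* B = 0 := by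
  -- The input `v^σ B` makes the derivative of `v · x` equal to the squared length of `v^σ B`.
  have hw : Continuous fun t => v t ᵥ* B := Continuous.matrix_vecMul hv continuous_const
  obtain ⟨x, hxc, hx⟩ := exists_isStateSolution hT hu A B ht₀ hw 0
  set S := T ∩ Ici t₀ with hSdef
  have hS := isClosed_inter_Ici hT t₀
  have hSu := not_bddAbove_inter_Ici hu t₀
  set w : ℝ → Fin m → ℝ := fun t => v (forwardJump T t) ᵥ* B with hwdef
  have hg : ∀ t ∈ S, t < tf → HasDeltaDerivAt S (fun t => v t ⬝ᵥ x t) (w t ⬝ᵥ w t) t := by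
    intro t ht httf
    refine (((hvd t ht.1 httf).mono ht.2).dotProduct (hx.2 t ht) hxc.continuousAt).congr_deriv ?_
    rw [forwardJump_inter_Ici T ht.2, dotProduct_add, Matrix.dotProduct_mulVec,
      Matrix.dotProduct_mulVec, neg_dotProduct]
    simp only [hwdef]
    ring
  have hg0 : v t₀ ⬝ᵥ x t₀ = 0 := by rw [hx.1, dotProduct_zero]
  have hgf : v tf ⬝ᵥ x tf = 0 := horth _ ⟨_, hw, x, hx, rfl⟩
  have hcont : Continuous fun t => v t ⬝ᵥ x t := Continuous.dotProduct hv hxc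
  have hmono : ∀ a ∈ S, ∀ t ∈ S, a ≤ t → t ≤ tf → v a ⬝ᵥ x a ≤ v t ⬝ᵥ x t := fun a ha =>
    monotoneOn_of_deltaDeriv_nonneg hS hSu (f := fun t => v t ⬝ᵥ x t) ha
      hcont.continuousOn
      (fun t ht _ httf => hg t ht httf) fun t _ _ _ => Finset.sum_nonneg fun i _ => mul_self_nonneg _
  have hzero : ∀ t ∈ S, t ≤ tf → v t ⬝ᵥ x t = 0 := fun t ht httf => le_antisymm
    (hgf ▸ hmono t ht tf ⟨htf, h0f.le⟩ httf le_rfl)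
    (hg0 ▸ hmono t₀ ⟨ht₀, mem_Ici.2 le_rfl⟩ t ht ht.2 httf)
  intro t ht h0t httf
  exact dotProduct_self_eq_zero.1 ((hg t ⟨ht, h0t⟩ httf).eq_zero_of_forall_eq_zero hS hSu
    ⟨ht, h0t⟩ ⟨htf, h0f.le⟩ httf fun s hs _ hsf => hzero s hs hsf)

theorem isControllableOn_of_pbhEigenvectorCondition (hT : IsClosed T) (hu : ¬ BddAbove T)
    {t₀ tf : ℝ} (ht₀ : t₀ ∈ T) (htf : tf ∈ T) (h0f : t₀ < tf)
    (hcard : (n : ℕ∞) ≤ (T ∩ Ico t₀ tf).encard) (h : PBHEigenvectorCondition A B) :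
    IsControllableOn T A B t₀ tf := by
  refine isControllableOn_of_reachableSubmodule_eq_top hT hu ht₀ ?_
  by_contra hne
  -- A proper subspace is annihilated by a nonzero functional, represented by `q`; the contradiction
  -- will be `q = 0`.
  obtain ⟨f, hf0, hf⟩ := Submodule.exists_le_ker_of_lt_top _ (lt_top_iff_ne_top.2 hne)
  obtain ⟨q, rfl⟩ := (dotProductEquiv ℝ (Fin n)).surjective f
  refine hf0 ?_
  rw [map_eq_zero_iff _ (LinearEquiv.injective _)]
  refine eq_zero_of_pbhEigenvectorCondition h (vecMul_pow_mul_eq_zero fun j hj => ?_)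
  obtain ⟨v, hvc, hvf, hvd⟩ := exists_backward_solution hT hu htf
    (LinearMap.toContinuousLinearMap A.vecMulLinear) q
  have hvB := vecMul_eq_zero_of_orthogonal_reachable (A := A) (B := B) hT hu ht₀ htf h0f hvc hvd
    (fun y hy => by rw [hvf]; exact hf hy)
  have hmem : ∀ k, (forwardJump T)^[k] t₀ ∈ T := fun k => by
    cases k with
    | zero => exact ht₀
    | succ k => rw [Function.iterate_succ_apply']; exact forwardJump_mem hT hu _
  have hiter : ∀ k, ∀ t ∈ T, (forwardJump T)^[k] t₀ ≤ t → t < tf →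
      v (forwardJump T t) ᵥ* (A ^ k * B) = 0 := by
    intro k
    induction k with
    | zero => simpa using hvB
    | succ k ih =>
      rw [Function.iterate_succ_apply', pow_succ', Matrix.mul_assoc]
      exact vecMul_mul_eq_zero_of_forall_forwardJump hT hu hvc htf hvd _ (hmem k) ih
  -- This is where the `n` points are spent: after `j < n` jumps there is still time left before
  -- `tf`.
  have hlt : (forwardJump T)^[j] t₀ < tf := by
    by_contra! hle
    have := hcard.trans (encard_inter_Ico_le_of_iterate_forwardJump j hle)
    exact absurd (Nat.cast_le.1 this) (not_le.2 hj)
  rw [← hvf]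
  exact vecMul_eq_zero_of_forall_forwardJump hT hu hvc _ (hmem j) (hiter j) tf htf hlt le_rfl

theorem exists_le_encard_inter_Ico (hu : ¬ BddAbove T) (t₀ : ℝ) (k : ℕ) :
    ∃ tf ∈ T, t₀ < tf ∧ (k : ℕ∞) ≤ (T ∩ Ico t₀ tf).encard := by
  have hinf : (T ∩ Ici t₀).Infinite := fun hfin => not_bddAbove_inter_Ici hu t₀ hfin.bddAbove
  obtain ⟨s, hs, hcard⟩ := hinf.exists_subset_card_eq k
  obtain ⟨c, hc⟩ := s.bddAbove
  obtain ⟨tf, htf, hlt⟩ := not_bddAbove_iff.1 hu (max c t₀)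
  refine ⟨tf, htf, (le_max_right _ _).trans_lt hlt, ?_⟩
  rw [← hcard, ← Set.encard_coe_eq_coe_finsetCard]
  exact Set.encard_le_encard fun x hx => ⟨(hs hx).1, (hs hx).2,
    (hc hx).trans_lt ((le_max_left _ _).trans_lt hlt)⟩

end Control

theorem theorem2p11 {n m : ℕ} (T : Set ℝ) (hT : IsClosed T) (hTunb : ¬ BddAbove T)
    (hTgrain : ∃ M : ℝ, ∀ t ∈ T, graininess T t ≤ M)
    (A : Matrix (Fin n) (Fin n) ℝ) (B : Matrix (Fin n) (Fin m) ℝ)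
    (hA : IsRegressive T A) (t₀ : ℝ) (ht₀ : t₀ ∈ T) :
    (IsControllable T A B t₀ ↔ PBHRankCondition A B) ∧
    (IsControllable T A B t₀ ↔ PBHEigenvectorCondition A B) ∧
    (∀ tf ∈ T, t₀ < tf → (n : ℕ∞) ≤ (T ∩ Set.Ico t₀ tf).encard →
      (IsControllableOn T A B t₀ tf ↔ PBHRankCondition A B)) := by
  have hiff := pbhRankCondition_iff_pbhEigenvectorCondition A B
  have hmain : IsControllable T A B t₀ ↔ PBHEigenvectorCondition A B := by
    constructor
    · rintro ⟨tf, htf, h0f, h⟩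
      exact pbhEigenvectorCondition_of_isControllableOn hT hTunb ht₀ htf h0f h
    · intro h
      obtain ⟨tf, htf, h0f, hcard⟩ := exists_le_encard_inter_Ico hTunb t₀ n
      exact ⟨tf, htf, h0f,
        isControllableOn_of_pbhEigenvectorCondition hT hTunb ht₀ htf h0f hcard h⟩
  refine ⟨hmain.trans hiff.symm, hmain, fun tf htf h0f hcard => ?_⟩
  rw [hiff]
  exact ⟨pbhEigenvectorCondition_of_isControllableOn hT hTunb ht₀ htf h0f,
    isControllableOn_of_pbhEigenvectorCondition hT hTunb ht₀ htf h0f hcard⟩
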